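/- A \emph{quantum board game} $G$ with finite outcome set $A$ is a protocol with finitely many rounds between a board and a single player, with finite-dimensional registers. The board starts in a fixed state; in each round it applies a fixed quantum operation (completely positive trace-preserving map) to its memory and the last message received, and sends a quantum message to the player; the player replies with a quantum message of prescribed dimension. After the last round the board applies a fixed measurement (POVM) $\{E_b\}_{b\in A}$ to its registers, and the result is the outcome. A \emph{strategy} consists of private memories of arbitrary finite dimension, an initial memory state, and for each round a quantum operation on the received message and the private memory. For $a\in A$ let $m^G(a)$ (or $m(a)$) be the minimal probability of the outcome $a$ over all strategies. Games $G_1,\dots,G_n$ are played \emph{in sequence} if $G_{i+1}$ is started, with a fresh board, after $G_i$ has ended and the player has learned the outcome of $G_i$; a sequential strategy keeps a private quantum memory throughout, and its operations in each game may depend on all earlier outcomes. Let $m^{seq}(a_1,\dots,a_n)$ be the minimal probability, over all sequential strategies, that the outcome of $G_i$ is $a_i$ for every $i$. \textbf{Theorem.} Let $G$ be a quantum board game, let $a$ be one of its outcomes, and let $n\ge 0$ be an integer. The minima $m(a)$ and $m^{seq}(a,\dots,a)$ (for $n$ sequential plays of $G$) are attained, and \[ m^{seq}(a,\dots,a)=m(a)^n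 . \] More generally there is no sequential hedging: for all board games $G_1,\dots,G_n$ and outcomes $a_i$ of $G_i$, \[ m^{seq}(a_1,\dots,a_n)=\prod_{i=1}^n m^{G_i}(a_i), \] and these minima, too, are attained. \textbf{Corollary.} Call a play of $G$ lost if its outcome is $a$ and won otherwise. If $S_1,\dots,S_n$ are strategies for $G$, each of which has probability $m(a)$ of the outcome $a$, then playing $S_1,\dots,S_n$ independently in the $n$ sequential plays maximizes, over all sequential strategies, the probability of winning at least one of the $n$ plays. -/

import Mathlib

open scoped Matrix Kronecker ComplexOrder

noncomputable section

/-- A density matrix (quantum state) on the finite-dimensional Hilbert space `ℂ^a`. -/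
structure DensityMatrix (a : Type) [Fintype a] where
  mat : Matrix a a ℂ
  posSemidef : mat.PosSemidef
  trace_eq_one : mat.trace = 1

/-- A quantum operation (completely positive trace preserving map) from operators on `ℂ^a` to
operators on `ℂ^b`, given by a finite family of Kraus operators `K j` with `∑ j, (K j)ᴴ * K j = 1`;
it acts by `ρ ↦ ∑ j, K j * ρ * (K j)ᴴ`. -/
structure QChannel (a b : Type) [Fintype a] [DecidableEq a] [Fintype b] where
  ι : Type
  [fintypeι : Fintype ι]
  kraus : ι → Matrix b a ℂ
  kraus_sum : ∑ j, (kraus j)ᴴ * kraus j = 1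

attribute [instance] QChannel.fintypeι

namespace QChannel

variable {a b c : Type} [Fintype a] [DecidableEq a] [Fintype b] [Fintype c] [DecidableEq c]

/-- The action of a quantum operation on operators. -/
def apply (Φ : QChannel a b) (ρ : Matrix a a ℂ) : Matrix b b ℂ :=
  ∑ j, Φ.kraus j * ρ * (Φ.kraus j)ᴴ

/-- `Φ ⊗ id`: the operation `Φ` is applied to the first of two registers. -/
def onLeft (Φ : QChannel a b) (ρ : Matrix (a × c) (a × c) ℂ) : Matrix (b × c) (b × c) ℂ :=
  ∑ j, (Φ.kraus j ⊗ₖ (1 : Matrix c c ℂ)) * ρ * (Φ.kraus j ⊗ₖ (1 : Matrix c c ℂ))ᴴ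

/-- `id ⊗ Φ`: the operation `Φ` is applied to the second of two registers. -/
def onRight (Φ : QChannel a b) (ρ : Matrix (c × a) (c × a) ℂ) : Matrix (c × b) (c × b) ℂ :=
  ∑ j, ((1 : Matrix c c ℂ) ⊗ₖ Φ.kraus j) * ρ * ((1 : Matrix c c ℂ) ⊗ₖ Φ.kraus j)ᴴ

end QChannel

open scoped MatrixOrder in
/-- A square root factor of a density matrix. -/
theorem DensityMatrix.exists_factor {b : Type} [Fintype b] (σ : DensityMatrix b) :
    ∃ R : Matrix b b ℂ, R * Rᴴ = σ.mat := by
  classical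
  obtain ⟨B, hB⟩ := CStarAlgebra.nonneg_iff_eq_star_mul_self.mp σ.posSemidef.nonneg
  exact ⟨Bᴴ, by rw [hB, Matrix.conjTranspose_conjTranspose]; rfl⟩

/-- The operation that discards its input and prepares the state `σ` (see `prepare_apply`). -/
def QChannel.prepare {a b : Type} [Fintype a] [DecidableEq a] [Fintype b]
    (σ : DensityMatrix b) : QChannel a b where
  ι := b × a
  kraus := fun j => Matrix.of fun p q => if q = j.2 then σ.exists_factor.choose p j.1 else 0
  kraus_sum := by
    have hR := σ.exists_factor.choose_spec
    set R := σ.exists_factor.choose with hRdef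
    have htr : ∑ x, ∑ p, star (R p x) * R p x = 1 := by
      have h1 : (R * Rᴴ).trace = 1 := by rw [hR, σ.trace_eq_one]
      rw [Finset.sum_comm, ← h1]
      simp [Matrix.trace, Matrix.mul_apply, mul_comm]
    ext q q'
    simp only [Matrix.sum_apply, Matrix.mul_apply, Matrix.conjTranspose_apply, Matrix.of_apply,
      Fintype.sum_prod_type, Matrix.one_apply]
    by_cases h : q = q'
    · subst h
      simp only [if_true, ← htr]
      refine Finset.sum_congr rfl fun x _ => ?_
      rw [Finset.sum_comm]
      refine Finset.sum_congr rfl fun p _ => ?_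
      simp
    · rw [if_neg h]
      refine Finset.sum_eq_zero fun x _ => Finset.sum_eq_zero fun y _ =>
        Finset.sum_eq_zero fun p _ => ?_
      by_cases h1 : q = y
      · have h2 : q' ≠ y := fun h2 => h (h1.trans h2.symm)
        simp [h2]
      · simp [h1]

theorem QChannel.prepare_apply {a b : Type} [Fintype a] [DecidableEq a] [Fintype b]
    (σ : DensityMatrix b) (ρ : Matrix a a ℂ) :
    (QChannel.prepare σ : QChannel a b).apply ρ = ρ.trace • σ.mat := by
  have hR := σ.exists_factor.choose_spec
  rw [← hR]
  ext p p'
  change (∑ j : b × a, (Matrix.of fun p q => if q = j.2 then σ.exists_factor.choose p j.1 else 0) *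
    ρ * (Matrix.of fun p q => if q = j.2 then σ.exists_factor.choose p j.1 else 0)ᴴ) p p' = _
  simp only [Matrix.sum_apply, Matrix.mul_apply, Matrix.conjTranspose_apply, Matrix.of_apply,
    Fintype.sum_prod_type, Matrix.smul_apply, Matrix.trace, Matrix.diag, smul_eq_mul,
    Finset.sum_mul]
  rw [Finset.sum_comm]
  refine Finset.sum_congr rfl fun l _ => ?_
  rw [Finset.mul_sum]
  refine Finset.sum_congr rfl fun x _ => ?_
  simp [apply_ite (starRingEnd ℂ)]
  ring

/-- The partial trace over the first of two registers. -/
def traceLeft {a c : Type} [Fintype a] (M : Matrix (a × c) (a × c) ℂ) : Matrix c c ℂ :=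
  Matrix.of fun p q => ∑ x, M (x, p) (x, q)

/-- A quantum board game with outcomes in `A`.

Before round `i` the board holds its memory `mem i` and the message `inp i` last received from the
player (for `i = 0` nothing has been received yet, and `inp 0` is merely part of the board's initial
registers). In round `i < rounds` the board applies the operation `op i`, keeps the register
`mem (i + 1)`, sends the register `out i` to the player and receives the reply `inp (i + 1)`.
After the last round it applies the measurement (POVM) `meas`. Data of index beyond `rounds` is
not used. -/
structure BoardGame (A : Type*) [Fintype A] where
  rounds : ℕ
  mem : ℕ → Type
  out : ℕ → Type
  inp : ℕ → Type
  [fintypeMem : ∀ i, Fintype (mem i)]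
  [decEqMem : ∀ i, DecidableEq (mem i)]
  [fintypeOut : ∀ i, Fintype (out i)]
  [decEqOut : ∀ i, DecidableEq (out i)]
  [fintypeInp : ∀ i, Fintype (inp i)]
  [decEqInp : ∀ i, DecidableEq (inp i)]
  [nonemptyInp : ∀ i, Nonempty (inp i)]
  init : DensityMatrix (mem 0 × inp 0)
  op : ∀ i, QChannel (mem i × inp i) (mem (i + 1) × out i)
  meas : A → Matrix (mem rounds × inp rounds) (mem rounds × inp rounds) ℂ
  meas_posSemidef : ∀ b, (meas b).PosSemidef
  meas_sum : ∑ b, meas b = 1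

attribute [instance] BoardGame.fintypeMem BoardGame.decEqMem BoardGame.fintypeOut
  BoardGame.decEqOut BoardGame.fintypeInp BoardGame.decEqInp BoardGame.nonemptyInp

namespace BoardGame

variable {A : Type*} [Fintype A]

/-- The operations that a player with private memory `pmem i` before round `i` applies during one
play of `G`: in round `i` the player turns the message `out i` and the memory `pmem i` into the
reply `inp (i + 1)` and the memory `pmem (i + 1)`. -/
abbrev PlayerOps (G : BoardGame A) (pmem : ℕ → Type) [∀ i, Fintype (pmem i)]
    [∀ i, DecidableEq (pmem i)] : Type 1 :=
  ∀ i, QChannel (G.out i × pmem i) (G.inp (i + 1) × pmem (i + 1))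

section Play

variable (G : BoardGame A) {pmem : ℕ → Type} [∀ i, Fintype (pmem i)] [∀ i, DecidableEq (pmem i)]

/-- The joint state of the board and the player before round `i`, when the player starts with the
(possibly unnormalized) memory state `ρ` and applies the operations `E`. -/
def jointState (E : G.PlayerOps pmem) (ρ : Matrix (pmem 0) (pmem 0) ℂ) :
    ∀ i, Matrix ((G.mem i × G.inp i) × pmem i) ((G.mem i × G.inp i) × pmem i) ℂ
  | 0 => G.init.mat ⊗ₖ ρ
  | i + 1 =>
    Matrix.reindex (Equiv.prodAssoc _ _ _).symm (Equiv.prodAssoc _ _ _).symm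
      ((E i).onRight
        (Matrix.reindex (Equiv.prodAssoc _ _ _) (Equiv.prodAssoc _ _ _)
          ((G.op i).onLeft (jointState E ρ i))))

/-- The unnormalized memory state of the player after the play, in the event that the outcome
is `b`; its trace is the probability of that event. -/
def postState (E : G.PlayerOps pmem) (ρ : Matrix (pmem 0) (pmem 0) ℂ) (b : A) :
    Matrix (pmem G.rounds) (pmem G.rounds) ℂ :=
  traceLeft ((G.meas b ⊗ₖ (1 : Matrix (pmem G.rounds) (pmem G.rounds) ℂ)) *
    G.jointState E ρ G.rounds)

end Play

/-- A strategy of the player for a single play of `G`: finite-dimensional private memories of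
arbitrary dimension, an initial state of the memory, and an operation for every round. -/
structure Strategy (G : BoardGame A) where
  pmem : ℕ → Type
  [fintypePmem : ∀ i, Fintype (pmem i)]
  [decEqPmem : ∀ i, DecidableEq (pmem i)]
  init : DensityMatrix (pmem 0)
  ops : G.PlayerOps pmem

attribute [instance] Strategy.fintypePmem Strategy.decEqPmem

/-- The probability of the outcome `b` when the player uses `S`. -/
def Strategy.prob {G : BoardGame A} (S : G.Strategy) (b : A) : ℝ :=
  (G.postState S.ops S.init.mat b).trace.re

/-- `m(a)`: the minimal probability of the outcome `a` in a single play. -/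
def minProb (G : BoardGame A) (a : A) : ℝ :=
  sInf (Set.range fun S : G.Strategy => S.prob a)

end BoardGame

/-- A strategy for playing the games `G 0`, `G 1`, ... one after another. The player keeps a private
memory throughout and knows the outcomes of all earlier games: the operations used in game `k` may
depend on the outcomes `h` of the games `0, ..., k - 1`. Between game `k` and game `k + 1`, when the
outcomes of the games `0, ..., k` are known, the player may apply a further operation `next k`
to the memory. -/
structure SeqStrategy {A : ℕ → Type*} [∀ k, Fintype (A k)] (G : ∀ k, BoardGame (A k)) where
  pmem : ℕ → ℕ → Type
  [fintypePmem : ∀ k i, Fintype (pmem k i)]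
  [decEqPmem : ∀ k i, DecidableEq (pmem k i)]
  init : DensityMatrix (pmem 0 0)
  ops : ∀ k, (∀ j : Fin k, A j) → (G k).PlayerOps (pmem k)
  next : ∀ k, (∀ j : Fin (k + 1), A j) → QChannel (pmem k (G k).rounds) (pmem (k + 1) 0)

attribute [instance] SeqStrategy.fintypePmem SeqStrategy.decEqPmem

namespace SeqStrategy

variable {A : ℕ → Type*} [∀ k, Fintype (A k)] {G : ∀ k, BoardGame (A k)}

/-- The unnormalized memory state of the player before game `k`, in the event that the outcomes of
the games `0, ..., k - 1` are `h`. Every game is played with a fresh board. -/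
def memState (S : SeqStrategy G) :
    ∀ k, (∀ j : Fin k, A j) → Matrix (S.pmem k 0) (S.pmem k 0) ℂ
  | 0, _ => S.init.mat
  | k + 1, h =>
    (S.next k h).apply
      ((G k).postState (S.ops k fun j => h j.castSucc) (S.memState k fun j => h j.castSucc)
        (h (Fin.last k)))

/-- The probability that the outcomes of the first `n` games are `v`. -/
def prob (S : SeqStrategy G) {n : ℕ} (v : ∀ j : Fin n, A j) : ℝ :=
  (S.memState n v).trace.re

open Classical in
/-- The probability of winning at least one of the first `n` games, where the `j`-th game is lost
exactly when its outcome is `a j`. -/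
def probWinSome (S : SeqStrategy G) {n : ℕ} (a : ∀ j : Fin n, A j) : ℝ :=
  ∑ v : (∀ j : Fin n, A j), if ∃ j, v j ≠ a j then S.prob v else 0

/-- Independent play: in each game `k` the player discards the old memory, prepares afresh the
initial memory of the single-game strategy `S k`, and plays `S k`, whatever happened before. -/
def independent (S : ∀ k, (G k).Strategy) : SeqStrategy G where
  pmem := fun k => (S k).pmem
  init := (S 0).init
  ops := fun k _ => (S k).ops
  next := fun k _ => QChannel.prepare (S (k + 1)).init

end SeqStrategy

/-- `m^seq(a)`: the minimal probability of the outcomes `a` in the first `n` games played in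
sequence. -/
def minSeqProb {A : ℕ → Type*} [∀ k, Fintype (A k)] (G : ∀ k, BoardGame (A k)) {n : ℕ}
    (a : ∀ j : Fin n, A j) : ℝ :=
  sInf (Set.range fun S : SeqStrategy G => S.prob a)

end

/-! Since every game has a fresh board, the past enters the next game only through the player's
memory. Conditioned on the earlier outcomes, that memory is in some state, which is also a
legitimate initial memory for a single play; so each conditional probability is at least the
single-game minimum. Homogeneity turns this into a bound for unnormalized states
(`minProb_mul_trace_le`), and induction gives the product as a lower bound (`prod_minProb_le_prob`).
Independent play of optimal strategies reaches it (`prob_independent`).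

The harder point is that a single-game minimum is attained, because the memory dimension is
unbounded. Every operation of the player is an isometry into the reply and a register of bounded
size, followed by an operation on that register alone (`exists_isometry_factor`). The second factor
commutes with the board's next operation, so it can be postponed and absorbed into the player's next
one; after the last round it no longer influences the outcome. Hence isometries on memories of fixed
dimension suffice (`exists_isometryOps_prob_eq`). They form a compact space on which the probability
is continuous.

For the corollary, winning at least once is the complement of losing every play. -/

noncomputable section

/-! ### Traces, partial traces and positivity -/

section MatrixFacts

variable {a b c : Type} [Fintype a] [Fintype b] [Fintype c]

theorem trace_sum_conj [DecidableEq a] {ι : Type} [Fintype ι] (K : ι → Matrix b a ℂ)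
    (hK : ∑ j, (K j)ᴴ * K j = 1) (ρ : Matrix a a ℂ) :
    (∑ j, K j * ρ * (K j)ᴴ).trace = ρ.trace := by
  rw [Matrix.trace_sum]
  simp_rw [fun j => Matrix.trace_mul_comm (K j * ρ) (K j)ᴴ, ← Matrix.mul_assoc]
  rw [← Matrix.trace_sum, ← Finset.sum_mul, hK, Matrix.one_mul]

theorem posSemidef_sum_conj {ι : Type} [Fintype ι] (K : ι → Matrix b a ℂ)
    {ρ : Matrix a a ℂ} (hρ : ρ.PosSemidef) : (∑ j, K j * ρ * (K j)ᴴ).PosSemidef :=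
  Matrix.posSemidef_sum _ fun j _ => hρ.mul_mul_conjTranspose_same (K j)

theorem sum_kraus_kronecker_one {a b c : Type} [DecidableEq a] [Fintype b] [Fintype c]
    [DecidableEq c] {ι : Type} [Fintype ι]
    (K : ι → Matrix b a ℂ) (hK : ∑ j, (K j)ᴴ * K j = 1) :
    ∑ j, (K j ⊗ₖ (1 : Matrix c c ℂ))ᴴ * (K j ⊗ₖ (1 : Matrix c c ℂ)) = 1 := by
  simp_rw [Matrix.conjTranspose_kronecker, ← Matrix.mul_kronecker_mul, Matrix.conjTranspose_one,
    Matrix.one_mul]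
  rw [← Matrix.one_kronecker_one, ← hK]
  ext i j
  simp [Matrix.sum_apply, Matrix.kroneckerMap_apply, Finset.sum_mul]

theorem sum_one_kronecker_kraus {a b c : Type} [DecidableEq a] [Fintype b] [Fintype c]
    [DecidableEq c] {ι : Type} [Fintype ι]
    (K : ι → Matrix b a ℂ) (hK : ∑ j, (K j)ᴴ * K j = 1) :
    ∑ j, ((1 : Matrix c c ℂ) ⊗ₖ K j)ᴴ * ((1 : Matrix c c ℂ) ⊗ₖ K j) = 1 := by
  simp_rw [Matrix.conjTranspose_kronecker, ← Matrix.mul_kronecker_mul, Matrix.conjTranspose_one,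
    Matrix.one_mul]
  rw [← Matrix.one_kronecker_one, ← hK]
  ext i j
  simp [Matrix.sum_apply, Matrix.kroneckerMap_apply, Finset.mul_sum]

theorem trace_reindex_self (e : a ≃ b) (M : Matrix a a ℂ) :
    (Matrix.reindex e e M).trace = M.trace := by
  simp only [Matrix.trace, Matrix.diag, Matrix.reindex_apply, Matrix.submatrix_apply]
  exact Equiv.sum_comp e.symm fun i => M i i

theorem reindex_mul_mul {a a' b b' : Type} [Fintype a] [Fintype a'] (e : a ≃ a') (f : b ≃ b')
    (K : Matrix b a ℂ) (ρ : Matrix a a ℂ) (L : Matrix a b ℂ) :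
    Matrix.reindex f f (K * ρ * L) =
      Matrix.reindex f e K * Matrix.reindex e e ρ * Matrix.reindex e f L := by
  simp [Matrix.submatrix_mul_equiv]

theorem trace_traceLeft (M : Matrix (a × c) (a × c) ℂ) : (traceLeft M).trace = M.trace := by
  simp [traceLeft, Matrix.trace, Fintype.sum_prod_type_right]

theorem traceLeft_posSemidef {a c : Type} [Fintype a]
    {M : Matrix (a × c) (a × c) ℂ} (hM : M.PosSemidef) :
    (traceLeft M).PosSemidef := by
  have h : traceLeft M = ∑ x : a, M.submatrix (Prod.mk x) (Prod.mk x) := by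
    ext p q
    simp [traceLeft, Matrix.sum_apply]
  rw [h]
  exact Matrix.posSemidef_sum _ fun x _ => hM.submatrix _

/-- A partial trace is not cyclic in general; it is so for factors that act only on the register
traced out. -/
theorem traceLeft_mul_comm [DecidableEq c] (M : Matrix a b ℂ) (N : Matrix (b × c) (a × c) ℂ) :
    traceLeft ((M ⊗ₖ (1 : Matrix c c ℂ)) * N) = traceLeft (N * (M ⊗ₖ (1 : Matrix c c ℂ))) := by
  ext p q
  simp only [traceLeft, Matrix.of_apply, Matrix.mul_apply, Matrix.kroneckerMap_apply,
    Fintype.sum_prod_type, Matrix.one_apply, mul_ite, mul_one, mul_zero, ite_mul, zero_mul,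
    Finset.sum_ite_eq, Finset.sum_ite_eq', Finset.mem_univ, if_true]
  rw [Finset.sum_comm]
  exact Finset.sum_congr rfl fun x _ => Finset.sum_congr rfl fun y _ => mul_comm _ _

open scoped MatrixOrder in
-- The product under the partial trace need not be Hermitian. Writing `M = Bᴴ * B` and moving `Bᴴ ⊗
-- 1` cyclically turns it into a conjugation of `N`, which is positive.
theorem traceLeft_effect_posSemidef [DecidableEq c] {M : Matrix a a ℂ} (hM : M.PosSemidef)
    {N : Matrix (a × c) (a × c) ℂ} (hN : N.PosSemidef) :
    (traceLeft ((M ⊗ₖ (1 : Matrix c c ℂ)) * N)).PosSemidef := by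
  classical
  obtain ⟨B, hB⟩ := CStarAlgebra.nonneg_iff_eq_star_mul_self.mp hM.nonneg
  have h : M ⊗ₖ (1 : Matrix c c ℂ) = (Bᴴ ⊗ₖ 1) * (B ⊗ₖ 1) := by
    rw [← Matrix.mul_kronecker_mul, Matrix.one_mul, hB]
    rfl
  rw [h, Matrix.mul_assoc, traceLeft_mul_comm]
  have h2 : Bᴴ ⊗ₖ (1 : Matrix c c ℂ) = (B ⊗ₖ 1)ᴴ := by
    rw [Matrix.conjTranspose_kronecker, Matrix.conjTranspose_one]
  rw [h2]
  exact traceLeft_posSemidef (hN.mul_mul_conjTranspose_same _)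

theorem ofReal_trace_re {M : Matrix a a ℂ} (hM : M.PosSemidef) :
    ((M.trace.re : ℝ) : ℂ) = M.trace := by
  have h := Complex.nonneg_iff.mp hM.trace_nonneg
  exact Complex.ext rfl (by simpa using h.2)

theorem trace_re_nonneg {M : Matrix a a ℂ} (hM : M.PosSemidef) : 0 ≤ M.trace.re :=
  (Complex.nonneg_iff.mp hM.trace_nonneg).1

end MatrixFacts

/-! ### Quantum operations preserve trace and positivity -/

namespace QChannel

variable {a b c : Type} [Fintype a] [DecidableEq a] [Fintype b] [Fintype c] [DecidableEq c]

theorem trace_apply (Φ : QChannel a b) (ρ : Matrix a a ℂ) : (Φ.apply ρ).trace = ρ.trace :=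
  trace_sum_conj _ Φ.kraus_sum ρ

theorem apply_posSemidef (Φ : QChannel a b) {ρ : Matrix a a ℂ} (hρ : ρ.PosSemidef) :
    (Φ.apply ρ).PosSemidef :=
  posSemidef_sum_conj _ hρ

theorem trace_onLeft (Φ : QChannel a b) (ρ : Matrix (a × c) (a × c) ℂ) :
    (Φ.onLeft ρ).trace = ρ.trace :=
  trace_sum_conj _ (sum_kraus_kronecker_one _ Φ.kraus_sum) ρ

theorem trace_onRight (Φ : QChannel a b) (ρ : Matrix (c × a) (c × a) ℂ) :
    (Φ.onRight ρ).trace = ρ.trace :=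
  trace_sum_conj _ (sum_one_kronecker_kraus _ Φ.kraus_sum) ρ

theorem onLeft_posSemidef (Φ : QChannel a b) {ρ : Matrix (a × c) (a × c) ℂ}
    (hρ : ρ.PosSemidef) : (Φ.onLeft ρ).PosSemidef :=
  posSemidef_sum_conj _ hρ

theorem onRight_posSemidef (Φ : QChannel a b) {ρ : Matrix (c × a) (c × a) ℂ}
    (hρ : ρ.PosSemidef) : (Φ.onRight ρ).PosSemidef :=
  posSemidef_sum_conj _ hρ

theorem onLeft_smul (Φ : QChannel a b) (t : ℂ) (ρ : Matrix (a × c) (a × c) ℂ) :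
    Φ.onLeft (t • ρ) = t • Φ.onLeft ρ := by
  simp [onLeft, Finset.smul_sum]

theorem onRight_smul (Φ : QChannel a b) (t : ℂ) (ρ : Matrix (c × a) (c × a) ℂ) :
    Φ.onRight (t • ρ) = t • Φ.onRight ρ := by
  simp [onRight, Finset.smul_sum]

end QChannel

/-! ### A single play from an unnormalized memory state -/

namespace BoardGame

variable {A : Type*} [Fintype A] (G : BoardGame A) {pmem : ℕ → Type} [∀ i, Fintype (pmem i)]
  [∀ i, DecidableEq (pmem i)] (E : G.PlayerOps pmem)

theorem jointState_smul (t : ℂ) (ρ : Matrix (pmem 0) (pmem 0) ℂ) (i : ℕ) :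
    G.jointState E (t • ρ) i = t • G.jointState E ρ i := by
  induction i with
  | zero => simp [jointState, Matrix.kronecker_smul]
  | succ i ih =>
    rw [jointState, jointState, ih, QChannel.onLeft_smul]
    simp only [Matrix.reindex_apply, Matrix.submatrix_smul, Pi.smul_apply, QChannel.onRight_smul]

theorem trace_jointState (ρ : Matrix (pmem 0) (pmem 0) ℂ) (i : ℕ) :
    (G.jointState E ρ i).trace = ρ.trace := by
  induction i with
  | zero => simp [jointState, Matrix.trace_kronecker, G.init.trace_eq_one]
  | succ i ih =>
    rw [jointState, trace_reindex_self, QChannel.trace_onRight, trace_reindex_self,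
      QChannel.trace_onLeft, ih]

theorem jointState_posSemidef {ρ : Matrix (pmem 0) (pmem 0) ℂ} (hρ : ρ.PosSemidef) (i : ℕ) :
    (G.jointState E ρ i).PosSemidef := by
  induction i with
  | zero => exact G.init.posSemidef.kronecker hρ
  | succ i ih =>
    rw [jointState]
    exact (QChannel.onRight_posSemidef _
      ((QChannel.onLeft_posSemidef _ ih).submatrix _)).submatrix _

theorem postState_posSemidef {ρ : Matrix (pmem 0) (pmem 0) ℂ} (hρ : ρ.PosSemidef) (b : A) :
    (G.postState E ρ b).PosSemidef :=
  traceLeft_effect_posSemidef (G.meas_posSemidef b) (G.jointState_posSemidef E hρ _)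

theorem trace_postState_smul (t : ℂ) (ρ : Matrix (pmem 0) (pmem 0) ℂ) (b : A) :
    (G.postState E (t • ρ) b).trace = t * (G.postState E ρ b).trace := by
  simp [postState, trace_traceLeft, jointState_smul]

theorem sum_trace_postState (ρ : Matrix (pmem 0) (pmem 0) ℂ) :
    ∑ b, (G.postState E ρ b).trace = ρ.trace := by
  simp only [postState, trace_traceLeft]
  rw [← Matrix.trace_sum, ← Finset.sum_mul]
  have h : ∑ b, G.meas b ⊗ₖ (1 : Matrix (pmem G.rounds) (pmem G.rounds) ℂ) = 1 := by
    rw [← Matrix.one_kronecker_one, ← G.meas_sum]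
    ext i j
    simp [Matrix.sum_apply, Matrix.kroneckerMap_apply, Finset.sum_mul]
  rw [h, Matrix.one_mul, trace_jointState]

theorem Strategy.prob_nonneg {G : BoardGame A} (S : G.Strategy) (b : A) : 0 ≤ S.prob b :=
  trace_re_nonneg (G.postState_posSemidef _ S.init.posSemidef b)

theorem Strategy.ofReal_prob {G : BoardGame A} (S : G.Strategy) (b : A) :
    ((S.prob b : ℝ) : ℂ) = (G.postState S.ops S.init.mat b).trace :=
  ofReal_trace_re (G.postState_posSemidef _ S.init.posSemidef b)

theorem minProb_nonneg (b : A) : 0 ≤ G.minProb b :=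
  Real.sInf_nonneg (by rintro _ ⟨S, rfl⟩; exact S.prob_nonneg b)

theorem minProb_le (S : G.Strategy) (b : A) : G.minProb b ≤ S.prob b :=
  csInf_le ⟨0, by rintro _ ⟨S, rfl⟩; exact S.prob_nonneg b⟩ ⟨S, rfl⟩

/-- The minimal probability of an outcome bounds its weight for every unnormalized initial memory
state of the player. -/
theorem minProb_mul_trace_le {ρ : Matrix (pmem 0) (pmem 0) ℂ} (hρ : ρ.PosSemidef) (b : A) :
    G.minProb b * ρ.trace.re ≤ (G.postState E ρ b).trace.re := by
  -- A state of trace zero cannot be normalized, but then the left side vanishes.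
  rcases (trace_re_nonneg hρ).eq_or_lt with h0 | h0
  · rw [← h0, mul_zero]
    exact trace_re_nonneg (G.postState_posSemidef E hρ b)
  · set t : ℝ := ρ.trace.re with ht
    have htr : ρ.trace = (t : ℂ) := (ofReal_trace_re hρ).symm
    have ht0 : (t : ℂ) ≠ 0 := by exact_mod_cast h0.ne'
    let σ : DensityMatrix (pmem 0) :=
      { mat := ((t⁻¹ : ℝ) : ℂ) • ρ
        posSemidef := hρ.smul (by exact_mod_cast inv_nonneg.mpr h0.le)
        trace_eq_one := by rw [Matrix.trace_smul, htr, smul_eq_mul]; push_cast; field_simp }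
    let S : G.Strategy := { pmem := pmem, init := σ, ops := E }
    have hS := G.minProb_le S b
    have hp : S.prob b = t⁻¹ * (G.postState E ρ b).trace.re := by
      change (G.postState E (((t⁻¹ : ℝ) : ℂ) • ρ) b).trace.re = _
      rw [trace_postState_smul, Complex.re_ofReal_mul]
    rw [hp] at hS
    calc G.minProb b * t ≤ t⁻¹ * (G.postState E ρ b).trace.re * t := by gcongr
      _ = _ := by field_simp

end BoardGame

/-! ### Compressing the player's memory by a polar decomposition -/

section Factorization

/-- A polar decomposition `T = W * S` in which `S` is in row-orthogonal form: the rows `m` with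
`Z m` of `S` vanish, and the other columns of `W` are orthonormal. -/
theorem exists_polar_factor {r n : Type} [Fintype r] [Fintype n] [DecidableEq n]
    (T : Matrix r n ℂ) :
    ∃ (W : Matrix r n ℂ) (S : Matrix n n ℂ) (Z : n → Prop) (_ : DecidablePred Z),
      W * S = T ∧ Sᴴ * S = Tᴴ * T ∧
      Wᴴ * W = Matrix.diagonal (fun m => if Z m then 0 else 1) ∧ ∀ m, Z m → ∀ x, S m x = 0 := by
  classical
  have hC : (Tᴴ * T).PosSemidef := Matrix.posSemidef_conjTranspose_mul_self T
  set e := hC.isHermitian.eigenvalues with he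
  have he0 : ∀ m, 0 ≤ e m := fun m => hC.eigenvalues_nonneg m
  set U : Matrix n n ℂ := (hC.isHermitian.eigenvectorUnitary : Matrix n n ℂ) with hU
  have hUU : Uᴴ * U = 1 := by
    rw [← Matrix.star_eq_conjTranspose]
    exact Unitary.coe_star_mul_self hC.isHermitian.eigenvectorUnitary
  have hUU' : U * Uᴴ = 1 := by
    rw [← Matrix.star_eq_conjTranspose]
    exact Unitary.coe_mul_star_self hC.isHermitian.eigenvectorUnitary
  have hspec : Tᴴ * T = U * Matrix.diagonal (fun m => (e m : ℂ)) * Uᴴ := by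
    have h := hC.isHermitian.spectral_theorem
    rw [Unitary.conjStarAlgAut_apply] at h
    exact h
  set N := T * U with hN
  have hNN : Nᴴ * N = Matrix.diagonal (fun m => (e m : ℂ)) := by
    calc Nᴴ * N = Uᴴ * (Tᴴ * T) * U := by
          simp only [hN, Matrix.conjTranspose_mul, Matrix.mul_assoc]
      _ = (Uᴴ * U) * Matrix.diagonal (fun m => (e m : ℂ)) * (Uᴴ * U) := by
          rw [hspec]; simp only [Matrix.mul_assoc]
      _ = _ := by rw [hUU, Matrix.one_mul, Matrix.mul_one]
  have hNT : N * Uᴴ = T := by rw [hN, Matrix.mul_assoc, hUU', Matrix.mul_one]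
  -- The columns of `N` are orthogonal with squared norms `e m`; those for the eigenvalue zero
  -- vanish.
  have hN0 : ∀ m, e m = 0 → ∀ i, N i m = 0 := by
    intro m hm i
    have h1 : (Nᴴ * N) m m = 0 := by rw [hNN]; simp [hm]
    simp only [Matrix.mul_apply, Matrix.conjTranspose_apply] at h1
    have h2 := (Finset.sum_eq_zero_iff_of_nonneg
      (fun j _ => star_mul_self_nonneg (N j m))).mp h1 i (Finset.mem_univ _)
    simpa using h2
  have hsq : ∀ m, ((√(e m) : ℝ) : ℂ) * ((√(e m) : ℝ) : ℂ) = (e m : ℂ) := fun m => by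
    rw [← Complex.ofReal_mul, Real.mul_self_sqrt (he0 m)]
  have hs0 : ∀ m, e m ≠ 0 → ((√(e m) : ℝ) : ℂ) ≠ 0 := fun m hm => by
    exact_mod_cast (Real.sqrt_ne_zero (he0 m)).mpr hm
  -- `W` normalizes the nonzero columns of `N`. The convention `0⁻¹ = 0` makes its other columns
  -- zero, which is harmless as those of `N` already vanish.
  refine ⟨N * Matrix.diagonal (fun m => ((√(e m) : ℝ) : ℂ)⁻¹),
    Matrix.diagonal (fun m => ((√(e m) : ℝ) : ℂ)) * Uᴴ, fun m => e m = 0, inferInstance,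
    ?_, ?_, ?_, ?_⟩
  · rw [Matrix.mul_assoc, ← Matrix.mul_assoc (Matrix.diagonal _), Matrix.diagonal_mul_diagonal,
      ← Matrix.mul_assoc]
    conv_rhs => rw [← hNT]
    congr 1
    ext i m
    rw [Matrix.mul_diagonal]
    by_cases hm : e m = 0
    · rw [hN0 m hm, zero_mul]
    · rw [inv_mul_cancel₀ (hs0 m hm), mul_one]
  · rw [hspec, Matrix.conjTranspose_mul, Matrix.conjTranspose_conjTranspose,
      Matrix.diagonal_conjTranspose, Matrix.mul_assoc, ← Matrix.mul_assoc (Matrix.diagonal _),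
      Matrix.diagonal_mul_diagonal, ← Matrix.mul_assoc]
    congr 3
    funext m
    simpa using hsq m
  · rw [Matrix.conjTranspose_mul, Matrix.mul_assoc, ← Matrix.mul_assoc Nᴴ, hNN,
      Matrix.diagonal_conjTranspose, Matrix.diagonal_mul_diagonal, Matrix.diagonal_mul_diagonal]
    congr 1
    funext m
    by_cases hm : e m = 0
    · simp [hm]
    · rw [if_neg hm, ← hsq m]
      have := hs0 m hm
      simp only [Pi.star_apply, star_inv₀, Complex.star_def, Complex.conj_ofReal]
      field_simp
  · intro m hm x
    simp [Matrix.diagonal_mul, hm]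

variable {X Y P : Type} [Fintype X] [DecidableEq X] [Fintype Y] [DecidableEq Y] [Fintype P]

theorem QChannel.nonempty_target {X Y : Type} [Fintype X] [DecidableEq X] [Fintype Y]
    (Ψ : QChannel X Y) (x : X) : Nonempty Y := by
  by_contra h
  rw [not_nonempty_iff] at h
  have h1 := congrFun (congrFun Ψ.kraus_sum x) x
  simp [Matrix.sum_apply, Matrix.mul_apply] at h1

/-- Every operation into a composite register `Y × P` can be carried out by an isometry into
`Y × (Y × X)` and an operation on the second register: a register of the bounded size `Y × X`
carries all the information that is needed later. -/
theorem QChannel.exists_isometry_factor [DecidableEq P] (Ψ : QChannel X (Y × P)) :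
    ∃ (V : Matrix (Y × (Y × X)) X ℂ) (Φ : QChannel (Y × X) P), Vᴴ * V = 1 ∧
      ∀ (c : Type) [Fintype c] [DecidableEq c] (ρ : Matrix (c × X) (c × X) ℂ),
        Ψ.onRight ρ = ∑ l, ((1 : Matrix c c ℂ) ⊗ₖ (((1 : Matrix Y Y ℂ) ⊗ₖ Φ.kraus l) * V)) * ρ *
          ((1 : Matrix c c ℂ) ⊗ₖ (((1 : Matrix Y Y ℂ) ⊗ₖ Φ.kraus l) * V))ᴴ := by
  -- The Kraus operators are reshaped so that `Y` moves from the rows to the columns. Then `S`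
  -- becomes the isometry, and `W` the Kraus operators of the later operation.
  obtain ⟨W, S, Z, _, hWS, hSS, hWW, hZ⟩ := exists_polar_factor
    (Matrix.of fun (i : Ψ.ι × P) (m : Y × X) => Ψ.kraus i.1 (m.1, i.2) m.2)
  -- `W` has zero columns at `Z`, so its Kraus operators preserve the trace only off `Z`. Extra ones
  -- send each basis vector in `Z` to an arbitrary basis vector of `P`.
  let p₀ : Y × X → P := fun m => (Ψ.nonempty_target m.2).some.2
  let V : Matrix (Y × (Y × X)) X ℂ := Matrix.of fun i x => S i.2 (i.1, x)
  let K : Ψ.ι ⊕ (Y × X) → Matrix P (Y × X) ℂ := Sum.elim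
    (fun j => Matrix.of fun p m => W (j, p) m)
    (fun m₀ => Matrix.of fun p m => if m = m₀ ∧ Z m ∧ p = p₀ m then 1 else 0)
  have hK : ∑ l, (K l)ᴴ * K l = 1 := by
    have h1 : ∑ j, (K (Sum.inl j))ᴴ * K (Sum.inl j) = Wᴴ * W := by
      ext m m'
      simp [K, Matrix.sum_apply, Matrix.mul_apply, Fintype.sum_prod_type]
    have h2 : ∑ j, (K (Sum.inr j))ᴴ * K (Sum.inr j) =
        Matrix.diagonal (fun m => if Z m then 1 else 0) := by
      ext m m'
      simp only [K, Matrix.sum_apply, Matrix.mul_apply, Sum.elim_inr, Matrix.conjTranspose_apply,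
        Matrix.of_apply, Matrix.diagonal_apply]
      by_cases h : m = m'
      · subst h
        rw [Finset.sum_eq_single m, Finset.sum_eq_single (p₀ m)]
        · by_cases hz : Z m <;> simp [hz]
        · intro p _ hp
          simp [hp]
        · simp
        · intro m₀ _ hm
          simp [hm.symm]
        · simp
      · rw [if_neg h]
        refine Finset.sum_eq_zero fun m₀ _ => Finset.sum_eq_zero fun p _ => ?_
        by_cases h1 : m = m₀
        · have h2 : m' ≠ m₀ := fun h2 => h (h1.trans h2.symm)
          simp [h2]
        · simp [h1]
    rw [Fintype.sum_sum_type, h1, h2, hWW, Matrix.diagonal_add, ← Matrix.diagonal_one]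
    congr 1
    funext m
    by_cases hz : Z m <;> simp [hz]
  have hinl : ∀ j, ((1 : Matrix Y Y ℂ) ⊗ₖ K (Sum.inl j)) * V = Ψ.kraus j := by
    intro j
    ext ⟨y, p⟩ x
    have h := congrFun (congrFun hWS (j, p)) (y, x)
    simp only [Matrix.mul_apply, Matrix.of_apply] at h
    rw [← h]
    simp [Matrix.mul_apply, Fintype.sum_prod_type, Matrix.one_apply, K, V]
  -- The extra Kraus operators never act, since the rows of `S` in `Z` vanish.
  have hinr : ∀ m, ((1 : Matrix Y Y ℂ) ⊗ₖ K (Sum.inr m)) * V = 0 := by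
    intro m₀
    ext ⟨y, p⟩ x
    simp only [Matrix.mul_apply, Matrix.zero_apply]
    refine Finset.sum_eq_zero fun m _ => ?_
    by_cases hz : Z m.2
    · simp [V, hZ m.2 hz]
    · simp [K, hz]
  refine ⟨V, { ι := Ψ.ι ⊕ (Y × X), kraus := K, kraus_sum := hK }, ?_, ?_⟩
  -- Summing the diagonal `Y`-blocks of `Sᴴ * S = Tᴴ * T` gives the Kraus sum of `Ψ`.
  · rw [← Ψ.kraus_sum]
    ext x x'
    have h : ∀ y, (Sᴴ * S) (y, x) (y, x') = _ := fun y => congrFun (congrFun hSS (y, x)) (y, x')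
    simp only [Matrix.mul_apply, Matrix.conjTranspose_apply, Matrix.of_apply] at h
    simp only [V, Matrix.mul_apply, Matrix.conjTranspose_apply, Matrix.of_apply, Matrix.sum_apply]
    rw [Fintype.sum_prod_type]
    simp_rw [h, Fintype.sum_prod_type]
    rw [Finset.sum_comm]
  · intro c _ _ ρ
    rw [QChannel.onRight]
    change _ = ∑ l : Ψ.ι ⊕ (Y × X), ((1 : Matrix c c ℂ) ⊗ₖ (((1 : Matrix Y Y ℂ) ⊗ₖ K l) * V)) * ρ *
          ((1 : Matrix c c ℂ) ⊗ₖ (((1 : Matrix Y Y ℂ) ⊗ₖ K l) * V))ᴴ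
    rw [Fintype.sum_sum_type]
    simp [hinl, hinr]

end Factorization

/-! ### Composing and commuting operations on composite registers -/

namespace QChannel

variable {a b c d : Type} [Fintype a] [DecidableEq a] [Fintype b] [DecidableEq b] [Fintype c]
  [DecidableEq c] [Fintype d] [DecidableEq d]

/-- The operation `id ⊗ Φ` on a composite register. -/
def amplify (c : Type) [Fintype c] [DecidableEq c] (Φ : QChannel a b) :
    QChannel (c × a) (c × b) where
  ι := Φ.ι
  kraus := fun j => (1 : Matrix c c ℂ) ⊗ₖ Φ.kraus j
  kraus_sum := sum_one_kronecker_kraus _ Φ.kraus_sum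

/-- The operation `Φ` followed by the operation `Ψ`. -/
def comp (Ψ : QChannel b c) (Φ : QChannel a b) : QChannel a c where
  ι := Φ.ι × Ψ.ι
  kraus := fun j => Ψ.kraus j.2 * Φ.kraus j.1
  kraus_sum := by
    rw [Fintype.sum_prod_type, ← Φ.kraus_sum]
    refine Finset.sum_congr rfl fun i _ => ?_
    simp_rw [Matrix.conjTranspose_mul, Matrix.mul_assoc, fun j => (Matrix.mul_assoc
      (Ψ.kraus j)ᴴ (Ψ.kraus j) (Φ.kraus i)).symm]
    rw [← Matrix.mul_sum, ← Matrix.sum_mul, Ψ.kraus_sum, Matrix.one_mul]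

/-- The operation with a single Kraus operator, an isometry. -/
def ofIsometry (V : Matrix b a ℂ) (hV : Vᴴ * V = 1) : QChannel a b where
  ι := Unit
  kraus := fun _ => V
  kraus_sum := by simpa using hV

theorem one_kronecker_mul {a b c d : Type} [Fintype b] [Fintype d] [DecidableEq d]
    (A : Matrix c b ℂ) (B : Matrix b a ℂ) :
    (1 : Matrix d d ℂ) ⊗ₖ (A * B) = ((1 : Matrix d d ℂ) ⊗ₖ A) * ((1 : Matrix d d ℂ) ⊗ₖ B) := by
  rw [← Matrix.mul_kronecker_mul, Matrix.one_mul]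

theorem onRight_comp {a b c d : Type} [Fintype a] [DecidableEq a] [Fintype b] [DecidableEq b]
    [Fintype c] [Fintype d] [DecidableEq d] (Ψ : QChannel b c) (Φ : QChannel a b)
    (ρ : Matrix (d × a) (d × a) ℂ) :
    (Ψ.comp Φ).onRight ρ = Ψ.onRight (Φ.onRight ρ) := by
  change ∑ j : Φ.ι × Ψ.ι, ((1 : Matrix d d ℂ) ⊗ₖ (Ψ.kraus j.2 * Φ.kraus j.1)) * ρ *
    ((1 : Matrix d d ℂ) ⊗ₖ (Ψ.kraus j.2 * Φ.kraus j.1))ᴴ = _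
  rw [onRight, Fintype.sum_prod_type_right]
  refine Finset.sum_congr rfl fun j _ => ?_
  rw [onRight, Matrix.mul_sum, Matrix.sum_mul]
  refine Finset.sum_congr rfl fun i _ => ?_
  simp only [one_kronecker_mul, Matrix.conjTranspose_mul, Matrix.mul_assoc]

theorem onRight_ofIsometry {a b c : Type} [Fintype a] [DecidableEq a] [Fintype b] [Fintype c]
    [DecidableEq c] (V : Matrix b a ℂ) (hV : Vᴴ * V = 1) (ρ : Matrix (c × a) (c × a) ℂ) :
    (ofIsometry V hV).onRight ρ =
      ((1 : Matrix c c ℂ) ⊗ₖ V) * ρ * ((1 : Matrix c c ℂ) ⊗ₖ V)ᴴ :=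
  Fintype.sum_unique (ι := Unit) fun _ =>
    ((1 : Matrix c c ℂ) ⊗ₖ V) * ρ * ((1 : Matrix c c ℂ) ⊗ₖ V)ᴴ

theorem onRight_kronecker {a b c : Type} [Fintype a] [DecidableEq a] [Fintype b] [Fintype c]
    [DecidableEq c] (Φ : QChannel a b) (M : Matrix c c ℂ) (ρ : Matrix a a ℂ) :
    Φ.onRight (M ⊗ₖ ρ) = M ⊗ₖ Φ.apply ρ := by
  have h : ∀ j, ((1 : Matrix c c ℂ) ⊗ₖ Φ.kraus j) * (M ⊗ₖ ρ) * ((1 : Matrix c c ℂ) ⊗ₖ Φ.kraus j)ᴴ =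
      M ⊗ₖ (Φ.kraus j * ρ * (Φ.kraus j)ᴴ) := fun j => by
    rw [Matrix.conjTranspose_kronecker, ← Matrix.mul_kronecker_mul, ← Matrix.mul_kronecker_mul,
      Matrix.conjTranspose_one, Matrix.one_mul, Matrix.mul_one]
  simp_rw [onRight, h, apply]
  ext i j
  simp [Matrix.sum_apply, Matrix.kroneckerMap_apply, Finset.mul_sum]

theorem kronecker_one_mul_comm (A : Matrix d c ℂ) (B : Matrix b a ℂ) :
    (A ⊗ₖ (1 : Matrix b b ℂ)) * ((1 : Matrix c c ℂ) ⊗ₖ B) =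
      ((1 : Matrix d d ℂ) ⊗ₖ B) * (A ⊗ₖ (1 : Matrix a a ℂ)) := by
  simp [← Matrix.mul_kronecker_mul]

/-- Operations on different registers commute; this carries a postponed operation of the player past
the board's move. -/
theorem onLeft_onRight (Ψ : QChannel c d) (Φ : QChannel a b) (ρ : Matrix (c × a) (c × a) ℂ) :
    Ψ.onLeft (Φ.onRight ρ) = Φ.onRight (Ψ.onLeft ρ) := by
  simp only [onLeft, onRight, Matrix.mul_sum, Matrix.sum_mul]
  rw [Finset.sum_comm]
  refine Finset.sum_congr rfl fun j _ => Finset.sum_congr rfl fun i _ => ?_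
  rw [← Matrix.mul_assoc, ← Matrix.mul_assoc, kronecker_one_mul_comm,
    Matrix.mul_assoc _ _ (Matrix.conjTranspose _), ← Matrix.conjTranspose_mul,
    kronecker_one_mul_comm, Matrix.conjTranspose_mul]
  simp only [Matrix.mul_assoc]

/-- No signalling: what the player does to the private register cannot change the board's
statistics. This discards the operation still pending after the last round. -/
theorem trace_kronecker_one_mul_onRight (Φ : QChannel a b) (M : Matrix c c ℂ)
    (ρ : Matrix (c × a) (c × a) ℂ) :
    ((M ⊗ₖ (1 : Matrix b b ℂ)) * Φ.onRight ρ).trace =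
      ((M ⊗ₖ (1 : Matrix a a ℂ)) * ρ).trace := by
  rw [← Φ.trace_onRight ((M ⊗ₖ (1 : Matrix a a ℂ)) * ρ)]
  congr 1
  simp only [onRight, Matrix.mul_sum]
  refine Finset.sum_congr rfl fun j _ => ?_
  rw [← Matrix.mul_assoc, ← Matrix.mul_assoc, kronecker_one_mul_comm]
  simp only [Matrix.mul_assoc]

theorem reindex_onRight {a b c d : Type} [Fintype a] [DecidableEq a] [Fintype b] [Fintype c]
    [DecidableEq c] [Fintype d] [DecidableEq d] (Φ : QChannel a b)
    (ρ : Matrix ((c × d) × a) ((c × d) × a) ℂ) :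
    Matrix.reindex (Equiv.prodAssoc _ _ _) (Equiv.prodAssoc _ _ _) (Φ.onRight ρ) =
      (Φ.amplify d).onRight
        (Matrix.reindex (Equiv.prodAssoc _ _ _) (Equiv.prodAssoc _ _ _) ρ) := by
  have h : ∀ j, Matrix.reindex (Equiv.prodAssoc c d b) (Equiv.prodAssoc c d a)
      ((1 : Matrix (c × d) (c × d) ℂ) ⊗ₖ Φ.kraus j) = (1 : Matrix c c ℂ) ⊗ₖ
        ((1 : Matrix d d ℂ) ⊗ₖ Φ.kraus j) := fun j => by
    rw [← Matrix.one_kronecker_one, Matrix.kronecker_assoc]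
  have h' : ∀ j, Matrix.reindex (Equiv.prodAssoc c d a) (Equiv.prodAssoc c d b)
      ((1 : Matrix (c × d) (c × d) ℂ) ⊗ₖ Φ.kraus j)ᴴ = ((1 : Matrix c c ℂ) ⊗ₖ
        ((1 : Matrix d d ℂ) ⊗ₖ Φ.kraus j))ᴴ := fun j => by
    rw [← h, Matrix.conjTranspose_reindex]
  have hsum : ∀ K : Φ.ι → Matrix ((c × d) × b) ((c × d) × b) ℂ,
      Matrix.reindex (Equiv.prodAssoc c d b) (Equiv.prodAssoc c d b) (∑ j, K j) =
        ∑ j, Matrix.reindex (Equiv.prodAssoc c d b) (Equiv.prodAssoc c d b) (K j) := fun K => by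
    ext
    simp [Matrix.sum_apply]
  rw [onRight, hsum]
  simp_rw [reindex_mul_mul (Equiv.prodAssoc c d a), h, h']
  rfl

theorem reindex_symm_onRight {a b c d : Type} [Fintype a] [DecidableEq a] [Fintype b]
    [Fintype c] [DecidableEq c] [Fintype d] [DecidableEq d] (Φ : QChannel a b)
    (ρ : Matrix (c × (d × a)) (c × (d × a)) ℂ) :
    Matrix.reindex (Equiv.prodAssoc _ _ _).symm (Equiv.prodAssoc _ _ _).symm
        ((Φ.amplify d).onRight ρ) =
      Φ.onRight
        (Matrix.reindex (Equiv.prodAssoc _ _ _).symm (Equiv.prodAssoc _ _ _).symm ρ) := by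
  apply (Matrix.reindex (Equiv.prodAssoc c d b) (Equiv.prodAssoc c d b)).injective
  rw [reindex_onRight]
  simp

end QChannel

/-- The defining equation is closed, and the columns are unit vectors, so every entry lies in the
closed unit disc. -/
instance compactSpace_isometries (a b : Type) [Fintype a] [DecidableEq a] [Fintype b] :
    CompactSpace {V : Matrix b a ℂ // Vᴴ * V = 1} := by
  apply isCompact_iff_compactSpace.mp
  have hbox : IsCompact (Set.univ.pi fun _ : b => Set.univ.pi fun _ : a =>
      Metric.closedBall (0 : ℂ) 1) :=
    isCompact_univ_pi fun _ => isCompact_univ_pi fun _ => isCompact_closedBall _ _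
  refine IsCompact.of_isClosed_subset (s := (Set.univ.pi fun _ : b => Set.univ.pi fun _ : a =>
    Metric.closedBall (0 : ℂ) 1 : Set (Matrix b a ℂ))) hbox ?_ ?_
  · exact isClosed_eq (continuous_id.matrix_conjTranspose.matrix_mul continuous_id)
      continuous_const
  · intro V' hV i _ j _
    let V : Matrix b a ℂ := V'
    change V i j ∈ _
    have h := congrFun (congrFun (show Vᴴ * V = 1 from hV) j) j
    simp only [Matrix.mul_apply, Matrix.conjTranspose_apply, Matrix.one_apply_eq] at h
    have h2 : ∑ k, ‖V k j‖ ^ 2 = 1 := by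
      have h3 : ((∑ k, ‖V k j‖ ^ 2 : ℝ) : ℂ) = 1 := by
        rw [← h]
        push_cast
        refine Finset.sum_congr rfl fun k _ => ?_
        rw [Complex.star_def, Complex.conj_mul']
      exact_mod_cast h3
    have h4 : ‖V i j‖ ^ 2 ≤ 1 := by
      rw [← h2]
      exact Finset.single_le_sum (f := fun k => ‖V k j‖ ^ 2) (fun k _ => sq_nonneg _)
        (Finset.mem_univ i)
    simpa using (sq_le_one_iff₀ (norm_nonneg _)).mp h4

/-! ### Bounded memories suffice, and the minimum is attained -/

namespace BoardGame

variable {A : Type*} [Fintype A]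

/-- Private memories of a bounded size that suffice for the player of `G`. -/
def boundedMem (G : BoardGame A) : ℕ → Type
  | 0 => Unit
  | i + 1 => G.inp (i + 1) × (G.out i × boundedMem G i)

instance fintypeBoundedMem (G : BoardGame A) : ∀ i, Fintype (G.boundedMem i)
  | 0 => inferInstanceAs (Fintype Unit)
  | i + 1 =>
    letI := fintypeBoundedMem G i
    inferInstanceAs (Fintype (G.inp (i + 1) × (G.out i × G.boundedMem i)))

instance decidableEqBoundedMem (G : BoardGame A) : ∀ i, DecidableEq (G.boundedMem i)
  | 0 => inferInstanceAs (DecidableEq Unit)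
  | i + 1 =>
    letI := decidableEqBoundedMem G i
    inferInstanceAs (DecidableEq (G.inp (i + 1) × (G.out i × G.boundedMem i)))

/-- A family of isometries, one for every round, on the bounded memories. -/
abbrev IsometryOps (G : BoardGame A) : Type :=
  ∀ i, {V : Matrix (G.inp (i + 1) × G.boundedMem (i + 1)) (G.out i × G.boundedMem i) ℂ //
    Vᴴ * V = 1}

instance nonempty_isometryOps (G : BoardGame A) : Nonempty G.IsometryOps := by
  refine ⟨fun i => ?_⟩
  let y : G.inp (i + 1) := Classical.choice (G.nonemptyInp (i + 1))
  let f : G.out i × G.boundedMem i → G.inp (i + 1) × G.boundedMem (i + 1) :=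
    fun x => (y, (y, x))
  have hf : Function.Injective f := fun x x' h => congrArg (fun p => p.2.2) h
  refine ⟨Matrix.of fun i x => if i = f x then 1 else 0, ?_⟩
  ext x x'
  simp [Matrix.mul_apply, Matrix.one_apply, hf.eq_iff, eq_comm]

/-- The player's operations given by isometries on the bounded memories. -/
def IsometryOps.ops {G : BoardGame A} (x : G.IsometryOps) : G.PlayerOps G.boundedMem :=
  fun i => QChannel.ofIsometry (x i).1 (x i).2

/-- The strategy given by isometries on the bounded memories. -/
def IsometryOps.strategy {G : BoardGame A} (x : G.IsometryOps) : G.Strategy where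
  pmem := G.boundedMem
  init :=
    -- The initial memory is one-dimensional, so the identity is its only state.
    { mat := 1
      posSemidef := Matrix.PosSemidef.one
      trace_eq_one := by 
        rw [Matrix.trace_one]
        exact (congrArg (Nat.cast (R := ℂ)) Fintype.card_unit).trans Nat.cast_one }
  ops := x.ops

/-- Every strategy is equivalent to one with isometries on the bounded memories. -/
theorem exists_isometryOps_prob_eq {G : BoardGame A} (S : G.Strategy) :
    ∃ x : G.IsometryOps, ∀ b, S.prob b = x.strategy.prob b := by
  choose V Φ' hV hΦ using fun (i : ℕ) (Φ : QChannel (G.boundedMem i) (S.pmem i)) =>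
    ((S.ops i).comp (Φ.amplify (G.out i))).exists_isometry_factor
  -- `Φ i` is the operation still pending before round `i`. It starts by preparing the memory of
  -- `S`; in each round it is merged with the player's operation, and the second factor of the
  -- result is pending next.
  let Φ : ∀ i, QChannel (G.boundedMem i) (S.pmem i) :=
    fun i => Nat.rec (QChannel.prepare S.init) (fun i Φ => Φ' i Φ) i
  let x : G.IsometryOps := fun i => ⟨V i (Φ i), hV i (Φ i)⟩
  have hstep : ∀ i (c : Type) [Fintype c] [DecidableEq c]
      (ρ : Matrix (c × (G.out i × G.boundedMem i)) (c × (G.out i × G.boundedMem i)) ℂ),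
      (S.ops i).onRight (((Φ i).amplify (G.out i)).onRight ρ) =
        ((Φ (i + 1)).amplify (G.inp (i + 1))).onRight ((x.ops i).onRight ρ) := by
    intro i c _ _ ρ
    rw [← QChannel.onRight_comp, hΦ i (Φ i) c ρ, IsometryOps.ops, QChannel.onRight_ofIsometry]
    refine Finset.sum_congr rfl fun l _ => ?_
    rw [QChannel.one_kronecker_mul, Matrix.conjTranspose_mul]
    simp only [Matrix.mul_assoc]
    rfl
  -- Invariant: performing the pending operation on the bounded memory recovers the joint state
  -- under `S`.
  have hjoint : ∀ i, G.jointState S.ops S.init.mat i =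
      (Φ i).onRight (G.jointState x.ops 1 i) := by
    intro i
    induction i with
    | zero =>
      rw [jointState, jointState, QChannel.onRight_kronecker]
      congr 1
      refine Eq.trans ?_ (QChannel.prepare_apply S.init _).symm
      have h : (1 : Matrix (G.boundedMem 0) (G.boundedMem 0) ℂ).trace = 1 :=
        x.strategy.init.trace_eq_one
      rw [h, one_smul]
    | succ i ih =>
      rw [jointState, jointState, ih, QChannel.onLeft_onRight, QChannel.reindex_onRight, hstep,
        QChannel.reindex_symm_onRight]
  refine ⟨x, fun b => ?_⟩
  rw [Strategy.prob, Strategy.prob, postState, postState, trace_traceLeft, trace_traceLeft, hjoint,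
    QChannel.trace_kronecker_one_mul_onRight]
  rfl

theorem continuous_kronecker_const {T : Type*} [TopologicalSpace T] {l m n p : Type}
    {f : T → Matrix l m ℂ} {g : T → Matrix n p ℂ} (hf : Continuous f) (hg : Continuous g) :
    Continuous fun t => f t ⊗ₖ g t :=
  continuous_matrix fun i j => (hf.matrix_elem i.1 j.1).mul (hg.matrix_elem i.2 j.2)

/-- The probability depends on finitely many isometries and is polynomial in their entries and the
conjugates of these. -/
theorem continuous_prob (G : BoardGame A) (b : A) :
    Continuous fun x : G.IsometryOps => x.strategy.prob b := by
  have hjoint : ∀ i, Continuous fun x : G.IsometryOps => G.jointState x.ops 1 i := by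
    intro i
    induction i with
    | zero => exact continuous_const
    | succ i ih =>
      have hL : Continuous fun x : G.IsometryOps =>
          (G.op i).onLeft (G.jointState x.ops 1 i) :=
        continuous_finsetSum _ fun j _ =>
          (continuous_const.matrix_mul ih).matrix_mul continuous_const
      have hR := hL.matrix_reindex (Equiv.prodAssoc _ _ _) (Equiv.prodAssoc _ _ _)
      have hV : Continuous fun x : G.IsometryOps =>
          (1 : Matrix (G.mem (i + 1)) (G.mem (i + 1)) ℂ) ⊗ₖ (x i).1 :=
        continuous_kronecker_const continuous_const
          (continuous_subtype_val.comp (continuous_apply i))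
      simp only [jointState, IsometryOps.ops, QChannel.onRight_ofIsometry]
      exact ((hV.matrix_mul hR).matrix_mul hV.matrix_conjTranspose).matrix_reindex _ _
  have h : Continuous fun x : G.IsometryOps =>
      ((G.meas b ⊗ₖ (1 : Matrix (G.boundedMem G.rounds) (G.boundedMem G.rounds) ℂ)) *
        G.jointState x.ops 1 G.rounds).trace.re :=
    Complex.continuous_re.comp (continuous_const.matrix_mul (hjoint _)).matrix_trace
  exact h.congr fun x => congrArg Complex.re (trace_traceLeft _).symm

theorem exists_forall_prob_le (G : BoardGame A) (b : A) :
    ∃ S : G.Strategy, ∀ S' : G.Strategy, S.prob b ≤ S'.prob b := by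
  obtain ⟨x, -, hx⟩ := isCompact_univ.exists_isMinOn (Set.univ_nonempty (α := G.IsometryOps))
    (G.continuous_prob b).continuousOn
  refine ⟨x.strategy, fun S' => ?_⟩
  obtain ⟨y, hy⟩ := exists_isometryOps_prob_eq S'
  rw [hy]
  exact hx (Set.mem_univ y)

/-- The minimal probability of an outcome is attained. -/
theorem isLeast_minProb (G : BoardGame A) (b : A) :
    IsLeast (Set.range fun S : G.Strategy => S.prob b) (G.minProb b) := by
  obtain ⟨S, hS⟩ := G.exists_forall_prob_le b
  have h : IsLeast (Set.range fun S : G.Strategy => S.prob b) (S.prob b) :=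
    ⟨⟨S, rfl⟩, by rintro _ ⟨S', rfl⟩; exact hS S'⟩
  have h2 : G.minProb b = S.prob b := h.csInf_eq
  rwa [h2]

end BoardGame

/-! ### Sequential play: the product bound and its attainment -/

namespace SeqStrategy

variable {A : ℕ → Type*} [∀ k, Fintype (A k)] {G : ∀ k, BoardGame (A k)}

theorem memState_posSemidef (S : SeqStrategy G) :
    ∀ (k : ℕ) (h : ∀ j : Fin k, A j), (S.memState k h).PosSemidef
  | 0, _ => S.init.posSemidef
  | k + 1, h => (S.next k h).apply_posSemidef
      ((G k).postState_posSemidef _ (S.memState_posSemidef k _) _)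

theorem trace_memState_succ (S : SeqStrategy G) (k : ℕ) (h : ∀ j : Fin (k + 1), A j) :
    (S.memState (k + 1) h).trace =
      ((G k).postState (S.ops k fun j => h j.castSucc) (S.memState k fun j => h j.castSucc)
        (h (Fin.last k))).trace := by
  rw [memState, QChannel.trace_apply]

theorem prod_minProb_le_prob (S : SeqStrategy G) :
    ∀ {n : ℕ} (b : ∀ j : Fin n, A j), ∏ j : Fin n, (G j).minProb (b j) ≤ S.prob b
  | 0, b => by
    have h : S.prob b = 1 := by
      rw [prob, memState, S.init.trace_eq_one, Complex.one_re]
    simp [h]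
  | n + 1, b => by
    have ih := S.prod_minProb_le_prob fun j : Fin n => b j.castSucc
    rw [Fin.prod_univ_castSucc, prob, trace_memState_succ]
    -- The unnormalized memory before the last game has as trace the probability of the earlier
    -- outcomes, so the single-game bound supplies exactly one more factor.
    refine le_trans ?_ ((G n).minProb_mul_trace_le _ (S.memState_posSemidef n _) _)
    rw [mul_comm]
    exact mul_le_mul_of_nonneg_left ih ((G n).minProb_nonneg _)

/-- Preparing a fresh memory keeps only the trace of the old one, so the history survives as a
scalar factor. -/
theorem memState_independent (S : ∀ k, (G k).Strategy) :
    ∀ (n : ℕ) (b : ∀ j : Fin n, A j), (independent S).memState n b =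
      ((∏ j : Fin n, (S j).prob (b j) : ℝ) : ℂ) • (S n).init.mat
  | 0, b => by
    rw [memState, Fin.prod_univ_zero, Complex.ofReal_one, one_smul]
    rfl
  | n + 1, b => by
    rw [memState, memState_independent S n, Fin.prod_univ_castSucc]
    refine (QChannel.prepare_apply (S (n + 1)).init _).trans ?_
    congr 1
    refine ((G n).trace_postState_smul (S n).ops _ _ _).trans ?_
    rw [Complex.ofReal_mul]
    congr 1
    exact ((S n).ofReal_prob _).symm

/-- Independent play yields independent outcomes. -/
theorem prob_independent (S : ∀ k, (G k).Strategy) {n : ℕ} (b : ∀ j : Fin n, A j) :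
    (independent S).prob b = ∏ j : Fin n, (S j).prob (b j) := by
  rw [prob, memState_independent]
  refine (congrArg Complex.re (Matrix.trace_smul _ (S n).init.mat)).trans ?_
  rw [(S n).init.trace_eq_one, smul_eq_mul, mul_one, Complex.ofReal_re]

theorem sum_trace_memState (S : SeqStrategy G) :
    ∀ n : ℕ, ∑ v : (∀ j : Fin n, A j), (S.memState n v).trace = 1
  | 0 => by simp [memState, S.init.trace_eq_one]
  | n + 1 => by
    rw [← (Fin.snocEquiv fun j : Fin (n + 1) => A j).sum_comp, Fintype.sum_prod_type_right,
      ← S.sum_trace_memState n]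
    refine Finset.sum_congr rfl fun v _ => ?_
    rw [← (G n).sum_trace_postState (S.ops n v)]
    refine Finset.sum_congr rfl fun b _ => ?_
    rw [trace_memState_succ]
    simp only [Fin.snocEquiv_apply, Fin.snoc_castSucc, Fin.snoc_last]

theorem sum_prob (S : SeqStrategy G) (n : ℕ) : ∑ v : (∀ j : Fin n, A j), S.prob v = 1 := by
  simp only [prob]
  rw [← Complex.re_sum, sum_trace_memState, Complex.one_re]

/-- Only the outcome list `a` wins nothing, and the probabilities of all lists sum to one. -/
theorem probWinSome_eq (S : SeqStrategy G) {n : ℕ} (a : ∀ j : Fin n, A j) :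
    S.probWinSome a = 1 - S.prob a := by
  classical
  rw [← S.sum_prob n, ← Finset.sum_erase_eq_sub (Finset.mem_univ a), probWinSome,
    ← Finset.sum_filter]
  refine Finset.sum_congr ?_ fun _ _ => rfl
  ext v
  simp [Function.ne_iff]

theorem isLeast_prob (G : ∀ k, BoardGame (A k)) {n : ℕ} (b : ∀ j : Fin n, A j) :
    IsLeast (Set.range fun S : SeqStrategy G => S.prob b)
      (∏ j : Fin n, (G j).minProb (b j)) := by
  -- A sequential strategy must specify play for all `k`; beyond the first `n` games any strategy
  -- will do. Here `nonempty_isometryOps` provides one.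
  have hS : ∀ k, ∃ S : (G k).Strategy, ∀ hk : k < n,
      S.prob (b ⟨k, hk⟩) = (G k).minProb (b ⟨k, hk⟩) := by
    intro k
    by_cases hk : k < n
    · obtain ⟨S, hS⟩ := ((G k).isLeast_minProb (b ⟨k, hk⟩)).1
      exact ⟨S, fun _ => hS⟩
    · exact ⟨(Classical.choice (G k).nonempty_isometryOps).strategy, fun h => absurd h hk⟩
  choose S hS using hS
  refine ⟨⟨independent S, ?_⟩, ?_⟩
  · exact (prob_independent S b).trans (Finset.prod_congr rfl fun j _ => hS j j.2)
  · rintro _ ⟨T, rfl⟩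
    exact T.prod_minProb_le_prob b

end SeqStrategy

theorem minSeqProb_eq_prod {A : ℕ → Type*} [∀ k, Fintype (A k)] (G : ∀ k, BoardGame (A k)) {n : ℕ}
    (b : ∀ j : Fin n, A j) : minSeqProb G b = ∏ j : Fin n, (G j).minProb (b j) :=
  (SeqStrategy.isLeast_prob G b).csInf_eq

theorem isLeast_minSeqProb {A : ℕ → Type*} [∀ k, Fintype (A k)] (G : ∀ k, BoardGame (A k)) {n : ℕ}
    (b : ∀ j : Fin n, A j) :
    IsLeast (Set.range fun S : SeqStrategy G => S.prob b) (minSeqProb G b) := by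
  rw [minSeqProb_eq_prod]
  exact SeqStrategy.isLeast_prob G b

end


theorem mainTheorem2 {A : Type*} [Fintype A] (G : BoardGame A) (a : A) (n : ℕ) :
    -- both minima exist
    IsLeast (Set.range fun S : G.Strategy => S.prob a) (G.minProb a) ∧
    IsLeast (Set.range fun S : SeqStrategy (fun _ : ℕ => G) => S.prob (fun _ : Fin n => a))
      (minSeqProb (fun _ : ℕ => G) (fun _ : Fin n => a)) ∧
    -- the minimal probability of the outcome `a` in all of `n` sequential plays of `G`
    minSeqProb (fun _ : ℕ => G) (fun _ : Fin n => a) = G.minProb a ^ n ∧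
    -- no sequential hedging, for different games and different outcomes
    (∀ (B : ℕ → Type*) [∀ k, Fintype (B k)] (H : ∀ k, BoardGame (B k)) (b : ∀ j : Fin n, B j),
      (∀ j : Fin n, IsLeast (Set.range fun S : (H j).Strategy => S.prob (b j))
        ((H j).minProb (b j))) ∧
      IsLeast (Set.range fun S : SeqStrategy H => S.prob b) (minSeqProb H b) ∧
      minSeqProb H b = ∏ j : Fin n, (H j).minProb (b j)) ∧
    -- independent optimal play is optimal for winning at least one of the `n` plays
    (∀ S : ℕ → G.Strategy, (∀ k, (S k).prob a = G.minProb a) →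
      IsGreatest
        (Set.range fun T : SeqStrategy (fun _ : ℕ => G) => T.probWinSome (fun _ : Fin n => a))
        ((SeqStrategy.independent (G := fun _ : ℕ => G) S).probWinSome (fun _ : Fin n => a))) := by
  refine ⟨G.isLeast_minProb a, isLeast_minSeqProb _ _, ?_, fun B _ H b =>
    ⟨fun j => (H j).isLeast_minProb (b j), isLeast_minSeqProb H b, minSeqProb_eq_prod H b⟩,
    fun S hS => ⟨⟨_, rfl⟩, ?_⟩⟩
  · rw [minSeqProb_eq_prod]
    simp
  · rintro _ ⟨T, rfl⟩
    have h := T.prod_minProb_le_prob fun _ : Fin n => a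
    have hind : (SeqStrategy.independent (G := fun _ : ℕ => G) S).prob (fun _ : Fin n => a) =
        ∏ _j : Fin n, G.minProb a :=
      (SeqStrategy.prob_independent (G := fun _ : ℕ => G) S fun _ : Fin n => a).trans
        (Finset.prod_congr rfl fun j _ => hS j)
    simp only [SeqStrategy.probWinSome_eq, hind]
    exact sub_le_sub_left h 1
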